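/- All rings below are additive abelian groups with a biadditive multiplication, not necessarily associative; "unital" means having a two-sided unit $1$. A \emph{hom-associative ring} is such a ring $S$ with an additive map $\alpha\colon S\to S$ (the twisting map) satisfying $\alpha(a)\cdot(b\cdot c)=(a\cdot b)\cdot\alpha(c)$ for all $a,b,c\in S$. A \emph{right (left) hom-ideal} of $S$ is an additive subgroup $I$ with $x\cdot s\in I$ (respectively $s\cdot x\in I$) for all $x\in I$, $s\in S$, and with $\alpha(I)\subseteq I$. The hom-associative ring $S$ is \emph{right (left) hom-noetherian} if it satisfies the ascending chain condition on right (left) hom-ideals. For a unital ring $R$ and additive maps $\sigma,\delta\colon R\to R$, let $\pi_i^m\colon R\to R$ denote the sum of all $\binom{m}{i}$ compositions of $i$ copies of $\sigma$ and $m-i$ copies of $\delta$ (with $\pi_0^0=\mathrm{id}_R$, and $\pi_i^m=0$ for $i>m$). The non-associative Ore extension $R[X;\sigma,\delta]$ is the additive group of formal sums $\sum_{i\in\mathbb{N}}a_iX^i$ with $a_i\in R$, finitely many nonzero, with the biadditive multiplication given by \[ aX^m\cdot bX^n=\sum_{i\in\mathbb{N}}\bigl(a\cdot\pi_i^m(b)\bigr)X^{i+n}\qquad(a,b\in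 R,\ m,n\in\mathbb{N}). \] \textbf{Theorem} (Hilbert's basis theorem for hom-associative rings). Let $R$ be a unital hom-associative ring with twisting map $\alpha$. Let $\sigma$ be an automorphism of the ring $R$ and let $\delta\colon R\to R$ be a $\sigma$-derivation, i.e. an additive map with $\delta(a\cdot b)=\sigma(a)\cdot\delta(b)+\delta(a)\cdot b$ for all $a,b\in R$. Assume that $\alpha\circ\sigma=\sigma\circ\alpha$ and $\alpha\circ\delta=\delta\circ\alpha$. Extend $\alpha$ homogeneously to $R[X;\sigma,\delta]$, that is, by $\alpha\bigl(\sum_i a_iX^i\bigr)=\sum_i\alpha(a_i)X^i$. Then $R[X;\sigma,\delta]$ is a hom-associative ring with this twisting map; if $R$ is right hom-noetherian, then $R[X;\sigma,\delta]$ is right hom-noetherian, and if $R$ is left hom-noetherian, then $R[X;\sigma,\delta]$ is left hom-noetherian. -/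

import Mathlib

section HomAssociative

variable {R : Type*} [NonUnitalNonAssocRing R]

/-- The additive map `α` is a twisting map making `R` a hom-associative ring:
`α(a)(bc) = (ab)α(c)` for all `a, b, c`. (The ring need not be associative, and `α` need not be
multiplicative.) -/
def IsHomAssociative (α : R →+ R) : Prop :=
  ∀ a b c : R, α a * (b * c) = (a * b) * α c

/-- The additive subgroup `I` is a right hom-ideal: a right ideal with `α(I) ⊆ I`. -/
structure IsRightHomIdeal (α : R →+ R) (I : AddSubgroup R) : Prop where
  mul_mem : ∀ x ∈ I, ∀ r : R, x * r ∈ I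
  map_mem : ∀ x ∈ I, α x ∈ I

/-- The additive subgroup `I` is a left hom-ideal: a left ideal with `α(I) ⊆ I`. -/
structure IsLeftHomIdeal (α : R →+ R) (I : AddSubgroup R) : Prop where
  mul_mem : ∀ x ∈ I, ∀ r : R, r * x ∈ I
  map_mem : ∀ x ∈ I, α x ∈ I

/-- `R`, with twisting map `α`, satisfies the ascending chain condition on right hom-ideals. -/
def IsRightHomNoetherian (α : R →+ R) : Prop :=
  ∀ I : ℕ → AddSubgroup R, (∀ n, IsRightHomIdeal α (I n)) → Monotone I →
    ∃ n, ∀ m, n ≤ m → I m = I n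

/-- `R`, with twisting map `α`, satisfies the ascending chain condition on left hom-ideals. -/
def IsLeftHomNoetherian (α : R →+ R) : Prop :=
  ∀ I : ℕ → AddSubgroup R, (∀ n, IsLeftHomIdeal α (I n)) → Monotone I →
    ∃ n, ∀ m, n ≤ m → I m = I n

end HomAssociative

section Ore

variable {R : Type*} [NonAssocRing R]

/-- `δ` is a `σ`-derivation: `δ(ab) = σ(a)δ(b) + δ(a)b`. -/
def IsSigmaDerivation (σ δ : R →+ R) : Prop :=
  ∀ a b : R, δ (a * b) = σ a * δ b + δ a * b

/-- The composition of a word of length `m` in `σ` and `δ`: the letter at position `j` is `σ` if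
`j ∈ s`, and `δ` otherwise. -/
def oreWord (σ δ : R →+ R) (m : ℕ) (s : Finset (Fin m)) : R →+ R :=
  (List.ofFn fun j : Fin m => if j ∈ s then σ else δ).foldr AddMonoidHom.comp (AddMonoidHom.id R)

/-- The map `π_i^m`: the sum of all `m.choose i` compositions of `i` copies of `σ` and `m - i`
copies of `δ`. -/
def oreMap (σ δ : R →+ R) (m i : ℕ) : R →+ R :=
  ∑ s ∈ (Finset.univ : Finset (Fin m)).powersetCard i, oreWord σ δ m s

/-- The multiplication of formal sums `∑ a_i X^i`, given on monomials by
`a X^m * b X^n = ∑_i (a * π_i^m(b)) X^(i+n)` and extended biadditively. Only `i ≤ m` is needed in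
the sum, as `π_i^m = 0` for `i > m`. -/
noncomputable def oreMul (σ δ : R →+ R) (p q : ℕ →₀ R) : ℕ →₀ R :=
  p.sum fun m a => q.sum fun n b =>
    ∑ i ∈ Finset.range (m + 1), Finsupp.single (i + n) (a * oreMap σ δ m i b)

theorem oreMul_add (σ δ : R →+ R) (p q r : ℕ →₀ R) :
    oreMul σ δ p (q + r) = oreMul σ δ p q + oreMul σ δ p r := by
  simp only [oreMul]
  rw [← Finsupp.sum_add]
  refine Finsupp.sum_congr fun m _ => ?_
  refine Finsupp.sum_add_index' (fun n => ?_) (fun n b c => ?_)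
  · simp
  · simp [mul_add, Finset.sum_add_distrib]

theorem add_oreMul (σ δ : R →+ R) (p q r : ℕ →₀ R) :
    oreMul σ δ (p + q) r = oreMul σ δ p r + oreMul σ δ q r := by
  simp only [oreMul]
  refine Finsupp.sum_add_index' (fun n => ?_) (fun n b c => ?_)
  · simp
  · rw [← Finsupp.sum_add]
    refine Finsupp.sum_congr fun m _ => ?_
    simp [add_mul, Finset.sum_add_distrib]

theorem zero_oreMul (σ δ : R →+ R) (p : ℕ →₀ R) : oreMul σ δ 0 p = 0 := by
  simp [oreMul]

theorem oreMul_zero (σ δ : R →+ R) (p : ℕ →₀ R) : oreMul σ δ p 0 = 0 := by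
  simp [oreMul, Finsupp.sum]

/-- The underlying set of the Ore extension `R[X; σ, δ]`: finitely supported families
`(a_i)`, standing for the formal sums `∑ a_i X^i` with coefficients on the left. -/
def OreExtension (_σ _δ : R →+ R) : Type _ := ℕ →₀ R

namespace OreExtension

variable {σ δ : R →+ R}

noncomputable instance : AddCommGroup (OreExtension σ δ) :=
  inferInstanceAs (AddCommGroup (ℕ →₀ R))

noncomputable instance : NonUnitalNonAssocRing (OreExtension σ δ) where
  mul p q := oreMul σ δ p q
  left_distrib p q r := oreMul_add σ δ p q r
  right_distrib p q r := add_oreMul σ δ p q r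
  zero_mul p := zero_oreMul σ δ p
  mul_zero p := oreMul_zero σ δ p

/-- The monomial `a X^m`, as an additive map in `a`. -/
noncomputable def monomial (m : ℕ) : R →+ OreExtension σ δ :=
  (Finsupp.singleAddHom m : R →+ (ℕ →₀ R))

theorem monomial_mul_monomial (m n : ℕ) (a b : R) :
    (monomial m a * monomial n b : OreExtension σ δ) =
      ∑ i ∈ Finset.range (m + 1), monomial (i + n) (a * oreMap σ δ m i b) := by
  change oreMul σ δ (Finsupp.single m a) (Finsupp.single n b) = _
  rw [oreMul, Finsupp.sum_single_index (by simp), Finsupp.sum_single_index (by simp)]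
  rfl

/-- The homogeneous extension `∑ a_i X^i ↦ ∑ α(a_i) X^i` of `α` to `R[X; σ, δ]`. -/
noncomputable def twist (σ δ : R →+ R) (α : R →+ R) : OreExtension σ δ →+ OreExtension σ δ :=
  (Finsupp.mapRange.addMonoidHom α : (ℕ →₀ R) →+ (ℕ →₀ R))

end OreExtension

end Ore

/-! Left multiplication by `X` is the operator `mulX`, which sends `p` to σ(p) shifted by one plus
δ(p), coefficientwise. By the recursion for the `oreMap`s, multiplying by aX^m on the left is `mulX`
iterated m times, then a on each coefficient (`monomial_mul`). Hom-associativity follows because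
X(pq) = (Xp)q and because `mulX` commutes with α.

For the chain conditions, the leading coefficients in degree d of a hom-ideal I form a hom-ideal of
R, increasing in I. Nested subgroups with the same leading coefficients in every degree are equal.
On the right these hom-ideals also increase with d; on the left, X applies σ to leading
coefficients, so their preimages under σ^d are used instead. A doubly monotone family stabilises
uniformly in d (`exists_forall_eq_of_monotone₂`), so generators are never needed. -/

section OreMap

/-! ### Pascal recursion for the maps π_i^m -/

variable {R : Type*} [NonAssocRing R] (σ δ : R →+ R)

theorem oreMap_zero_zero : oreMap σ δ 0 0 = AddMonoidHom.id R := by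
  simp [oreMap, oreWord]

theorem oreMap_eq_zero {m i : ℕ} (h : m < i) : oreMap σ δ m i = 0 := by
  rw [oreMap, Finset.powersetCard_eq_empty.2 (by simpa using h), Finset.sum_empty]

theorem oreWord_succ_map (m : ℕ) (s : Finset (Fin m)) :
    oreWord σ δ (m + 1) (s.map (Fin.succEmb m)) = δ.comp (oreWord σ δ m s) := by
  simp [oreWord, List.ofFn_succ, Fin.succ_ne_zero]

theorem oreWord_succ_insert (m : ℕ) (s : Finset (Fin m)) :
    oreWord σ δ (m + 1) (insert 0 (s.map (Fin.succEmb m))) = σ.comp (oreWord σ δ m s) := by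
  simp [oreWord, List.ofFn_succ, Fin.succ_ne_zero]

theorem oreMap_succ_zero (m : ℕ) : oreMap σ δ (m + 1) 0 = δ.comp (oreMap σ δ m 0) := by
  simpa [oreMap] using oreWord_succ_map σ δ m ∅

/-- Split the words by their outermost letter, the one at position 0. -/
theorem oreMap_succ_succ (m i : ℕ) (a : R) :
    oreMap σ δ (m + 1) (i + 1) a = σ (oreMap σ δ m i a) + δ (oreMap σ δ m (i + 1) a) := by
  have h0 : (0 : Fin (m + 1)) ∉ (Finset.univ : Finset (Fin m)).map (Fin.succEmb m) := by
    simp [Fin.succ_ne_zero]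
  have hu : (Finset.univ : Finset (Fin (m + 1))) =
      insert 0 (Finset.univ.map (Fin.succEmb m)) := by
    rw [Fin.univ_succ, Finset.cons_eq_insert]
    rfl
  rw [oreMap, hu, Finset.powersetCard_succ_insert h0, Finset.sum_union, add_comm]
  · rw [Finset.sum_image, Finset.powersetCard_map, Finset.powersetCard_map, Finset.sum_map,
      Finset.sum_map]
    · simp only [oreMap, AddMonoidHom.add_apply, AddMonoidHom.finsetSum_apply, map_sum]
      congr 1
      · exact Finset.sum_congr rfl fun s _ =>
          DFunLike.congr_fun (oreWord_succ_insert σ δ m s) a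
      · exact Finset.sum_congr rfl fun s _ =>
          DFunLike.congr_fun (oreWord_succ_map σ δ m s) a
    · intro s hs t ht hst
      have hs' : (0 : Fin (m + 1)) ∉ s := fun h => h0 ((Finset.mem_powersetCard.1 hs).1 h)
      have ht' : (0 : Fin (m + 1)) ∉ t := fun h => h0 ((Finset.mem_powersetCard.1 ht).1 h)
      rw [← Finset.erase_insert hs', ← Finset.erase_insert ht']
      exact congrArg (fun u => u.erase 0) hst
  · rw [Finset.disjoint_left]
    intro s hs hs'
    obtain ⟨t, -, rfl⟩ := Finset.mem_image.1 hs'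
    exact h0 ((Finset.mem_powersetCard.1 hs).1 (Finset.mem_insert_self _ _))

end OreMap

/-- The `m`-fold iterate of an additive map, as an additive map. -/
def AddMonoidHom.iterateHom {A : Type*} [AddZeroClass A] (f : A →+ A) (m : ℕ) : A →+ A where
  toFun := f^[m]
  map_zero' := iterate_map_zero f m
  map_add' := iterate_map_add f m

theorem AddMonoidHom.iterateHom_apply {A : Type*} [AddZeroClass A] (f : A →+ A) (m : ℕ) (a : A) :
    f.iterateHom m a = f^[m] a := rfl

namespace OreExtension

/-! ### Multiplication by `X` and hom-associativity -/

section Operators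

variable {R : Type*} [NonAssocRing R] {σ δ : R →+ R}

theorem addHom_ext_monomial {M : Type*} [AddZeroClass M] {f g : OreExtension σ δ →+ M}
    (h : ∀ n a, f (monomial n a) = g (monomial n a)) : f = g :=
  Finsupp.addHom_ext h

/-- The coefficient of `X^k`. -/
noncomputable def coeff (k : ℕ) : OreExtension σ δ →+ R :=
  (Finsupp.applyAddHom k : (ℕ →₀ R) →+ R)

theorem coeff_monomial (k n : ℕ) (a : R) :
    coeff k (monomial n a : OreExtension σ δ) = if n = k then a else 0 :=
  Finsupp.single_apply

theorem coeff_ext {p q : OreExtension σ δ} (h : ∀ k, coeff k p = coeff k q) : p = q :=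
  Finsupp.ext h

theorem exists_coeff_eq_zero (p : OreExtension σ δ) : ∃ d, ∀ k, d ≤ k → coeff k p = 0 := by
  refine ⟨(Finsupp.support p).sup id + 1, fun k hk => ?_⟩
  by_contra h
  have : k ≤ (Finsupp.support p).sup id :=
    Finset.le_sup (f := id) (Finsupp.mem_support_iff.2 h)
  omega

/-- The additive map applying `f` to every coefficient. -/
noncomputable def mapCoeff (f : R →+ R) : OreExtension σ δ →+ OreExtension σ δ :=
  (Finsupp.mapRange.addMonoidHom f : (ℕ →₀ R) →+ (ℕ →₀ R))

theorem coeff_mapCoeff (f : R →+ R) (k : ℕ) (p : OreExtension σ δ) :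
    coeff k (mapCoeff f p) = f (coeff k p) :=
  Finsupp.mapRange_apply (hf := f.map_zero) ..

theorem mapCoeff_monomial (f : R →+ R) (n : ℕ) (a : R) :
    mapCoeff f (monomial n a : OreExtension σ δ) = monomial n (f a) :=
  Finsupp.mapRange_single (hf := f.map_zero)

theorem twist_eq_mapCoeff (α : R →+ R) : twist σ δ α = mapCoeff α := rfl

/-- The additive map `∑ a_i X^i ↦ ∑ a_i X^(i+1)`. -/
noncomputable def shift : OreExtension σ δ →+ OreExtension σ δ :=
  (Finsupp.mapDomain.addMonoidHom Nat.succ : (ℕ →₀ R) →+ (ℕ →₀ R))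

theorem shift_monomial (n : ℕ) (a : R) :
    shift (monomial n a : OreExtension σ δ) = monomial (n + 1) a :=
  Finsupp.mapDomain_single

theorem coeff_shift_succ (k : ℕ) (p : OreExtension σ δ) :
    coeff (k + 1) (shift p) = coeff k p :=
  Finsupp.mapDomain_apply Nat.succ_injective p k

/-- Left multiplication by `X`. -/
noncomputable def mulX : OreExtension σ δ →+ OreExtension σ δ :=
  shift.comp (mapCoeff σ) + mapCoeff δ

theorem mulX_monomial (n : ℕ) (a : R) :
    mulX (monomial n a : OreExtension σ δ) = monomial (n + 1) (σ a) + monomial n (δ a) := by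
  simp [mulX, mapCoeff_monomial, shift_monomial]

theorem coeff_succ_mulX (k : ℕ) (p : OreExtension σ δ) :
    coeff (k + 1) (mulX p) = σ (coeff k p) + δ (coeff (k + 1) p) := by
  simp [mulX, coeff_mapCoeff, coeff_shift_succ]

theorem iterate_mulX_monomial (m n : ℕ) (b : R) :
    mulX^[m] (monomial n b : OreExtension σ δ) =
      ∑ i ∈ Finset.range (m + 1), monomial (i + n) (oreMap σ δ m i b) := by
  induction m with
  | zero => simp [oreMap_zero_zero]
  | succ m ih =>
    rw [Function.iterate_succ_apply', ih, map_sum, Finset.sum_range_succ' _ (m + 1)]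
    simp only [mulX_monomial, Finset.sum_add_distrib, oreMap_succ_succ, oreMap_succ_zero, map_add,
      AddMonoidHom.comp_apply, add_assoc]
    congr 1
    · exact Finset.sum_congr rfl fun i _ => by rw [add_comm 1 n]
    · rw [Finset.sum_range_succ', Finset.sum_range_succ, oreMap_eq_zero σ δ (Nat.lt_succ_self m)]
      simp [add_assoc]

theorem mulX_monomial_one (hσ : σ 1 = 1) (hδ : δ 1 = 0) (n : ℕ) :
    mulX (monomial n 1 : OreExtension σ δ) = monomial (n + 1) 1 := by
  rw [mulX_monomial, hσ, hδ, map_zero, add_zero]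

theorem monomial_mul (m : ℕ) (a : R) (q : OreExtension σ δ) :
    monomial m a * q = mapCoeff (AddMonoidHom.mulLeft a) (mulX^[m] q) := by
  have : AddMonoidHom.mulLeft (monomial m a : OreExtension σ δ) =
      (mapCoeff (AddMonoidHom.mulLeft a)).comp (mulX.iterateHom m) := by
    refine addHom_ext_monomial fun n b => ?_
    rw [AddMonoidHom.comp_apply, AddMonoidHom.iterateHom_apply, iterate_mulX_monomial, map_sum]
    simp only [mapCoeff_monomial, AddMonoidHom.coe_mulLeft]
    exact monomial_mul_monomial m n a b
  have h := DFunLike.congr_fun this q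
  rwa [AddMonoidHom.comp_apply, AddMonoidHom.iterateHom_apply] at h

theorem monomial_zero_mul (a : R) (q : OreExtension σ δ) :
    monomial 0 a * q = mapCoeff (AddMonoidHom.mulLeft a) q :=
  monomial_mul 0 a q

theorem monomial_one_mul (q : OreExtension σ δ) : monomial 1 1 * q = mulX q := by
  rw [monomial_mul]
  exact coeff_ext fun k => by simp [coeff_mapCoeff]

theorem mulX_mapCoeff_mulLeft (hσ : ∀ a b, σ (a * b) = σ a * σ b) (hδ : IsSigmaDerivation σ δ)
    (a : R) (p : OreExtension σ δ) :
    mulX (mapCoeff (AddMonoidHom.mulLeft a) p) =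
      mapCoeff (AddMonoidHom.mulLeft (σ a)) (mulX p) +
        mapCoeff (AddMonoidHom.mulLeft (δ a)) p := by
  refine DFunLike.congr_fun (f := mulX.comp (mapCoeff (AddMonoidHom.mulLeft a)))
    (g := (mapCoeff (AddMonoidHom.mulLeft (σ a))).comp mulX +
      mapCoeff (AddMonoidHom.mulLeft (δ a))) (addHom_ext_monomial fun n b => ?_) p
  simp [mapCoeff_monomial, mulX_monomial, hσ, hδ a b, add_assoc]

/-- `X` associates with all p, q although R need not be associative: on p = aX^m this is the
coefficientwise σ-derivation rule. -/
theorem mulX_mul (hσ : ∀ a b, σ (a * b) = σ a * σ b) (hδ : IsSigmaDerivation σ δ)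
    (p q : OreExtension σ δ) : mulX (p * q) = mulX p * q := by
  refine DFunLike.congr_fun (f := mulX.comp (AddMonoidHom.mulRight q))
    (g := (AddMonoidHom.mulRight q).comp mulX) (addHom_ext_monomial fun m a => ?_) p
  simp only [AddMonoidHom.comp_apply, AddMonoidHom.mulRight_apply]
  rw [monomial_mul, mulX_mapCoeff_mulLeft hσ hδ, mulX_monomial, add_mul, monomial_mul,
    monomial_mul, Function.iterate_succ_apply']

theorem iterate_mulX_mul (hσ : ∀ a b, σ (a * b) = σ a * σ b) (hδ : IsSigmaDerivation σ δ)
    (m : ℕ) (p q : OreExtension σ δ) : mulX^[m] (p * q) = mulX^[m] p * q := by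
  induction m with
  | zero => rfl
  | succ m ih => rw [Function.iterate_succ_apply', ih, mulX_mul hσ hδ, Function.iterate_succ_apply']

theorem mulX_mapCoeff {α : R →+ R} (hσ : ∀ a, α (σ a) = σ (α a)) (hδ : ∀ a, α (δ a) = δ (α a))
    (p : OreExtension σ δ) : mulX (mapCoeff α p) = mapCoeff α (mulX p) := by
  refine DFunLike.congr_fun (f := mulX.comp (mapCoeff α)) (g := (mapCoeff α).comp mulX)
    (addHom_ext_monomial fun n a => ?_) p
  simp [mapCoeff_monomial, mulX_monomial, hσ, hδ]

theorem iterate_mulX_mapCoeff {α : R →+ R} (hσ : ∀ a, α (σ a) = σ (α a))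
    (hδ : ∀ a, α (δ a) = δ (α a)) (m : ℕ) (p : OreExtension σ δ) :
    mulX^[m] (mapCoeff α p) = mapCoeff α (mulX^[m] p) :=
  Function.Commute.iterate_left (f := mulX) (g := mapCoeff α) (mulX_mapCoeff hσ hδ) m p

/-- Hom-associativity with a constant as first factor; powers of `X` in front are handled by
`mulX_mul`. -/
theorem mapCoeff_mulLeft_mul {α : R →+ R} (hα : IsHomAssociative α)
    (hασ : ∀ a, α (σ a) = σ (α a)) (hαδ : ∀ a, α (δ a) = δ (α a)) (a : R)
    (p q : OreExtension σ δ) :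
    mapCoeff (AddMonoidHom.mulLeft (α a)) (p * q) =
      mapCoeff (AddMonoidHom.mulLeft a) p * mapCoeff α q := by
  refine DFunLike.congr_fun
    (f := (mapCoeff (AddMonoidHom.mulLeft (α a))).comp (AddMonoidHom.mulRight q))
    (g := (AddMonoidHom.mulRight (mapCoeff α q)).comp (mapCoeff (AddMonoidHom.mulLeft a)))
    (addHom_ext_monomial fun m b => ?_) p
  simp only [AddMonoidHom.comp_apply, AddMonoidHom.mulRight_apply, mapCoeff_monomial]
  rw [monomial_mul, monomial_mul, iterate_mulX_mapCoeff hασ hαδ]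
  exact coeff_ext fun k => by
    simpa [coeff_mapCoeff] using hα a b _

theorem isHomAssociative_twist {α : R →+ R} (hα : IsHomAssociative α)
    (hσ : ∀ a b, σ (a * b) = σ a * σ b) (hδ : IsSigmaDerivation σ δ)
    (hασ : ∀ a, α (σ a) = σ (α a)) (hαδ : ∀ a, α (δ a) = δ (α a)) :
    IsHomAssociative (twist σ δ α) := by
  intro p q r
  rw [twist_eq_mapCoeff]
  refine DFunLike.congr_fun (f := (AddMonoidHom.mulRight (q * r)).comp (mapCoeff α))
    (g := (AddMonoidHom.mulRight (mapCoeff α r)).comp (AddMonoidHom.mulRight q))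
    (addHom_ext_monomial fun m a => ?_) p
  simp only [AddMonoidHom.comp_apply, AddMonoidHom.mulRight_apply, mapCoeff_monomial]
  rw [monomial_mul, monomial_mul, iterate_mulX_mul hσ hδ, mapCoeff_mulLeft_mul hα hασ hαδ]

theorem mul_monomial_one (hσ : σ 1 = 1) (hδ : δ 1 = 0) (p : OreExtension σ δ) :
    p * monomial 1 1 = shift p := by
  refine DFunLike.congr_fun (f := AddMonoidHom.mulRight (monomial 1 1)) (g := shift)
    (addHom_ext_monomial fun m a => ?_) p
  have h : ∀ m, mulX^[m] (monomial 1 1 : OreExtension σ δ) = monomial (m + 1) 1 := by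
    intro m
    induction m with
    | zero => rfl
    | succ m ih => rw [Function.iterate_succ_apply', ih, mulX_monomial_one hσ hδ]
  rw [AddMonoidHom.mulRight_apply, monomial_mul, h, mapCoeff_monomial, shift_monomial]
  simp

end Operators

/-! ### Leading coefficients of hom-ideals -/

section LeadingCoeff

variable {R : Type*} [NonAssocRing R] {σ δ : R →+ R}

/-- The elements of degree at most `d`. -/
noncomputable def degreeLE (σ δ : R →+ R) (d : ℕ) : AddSubgroup (OreExtension σ δ) :=
  ⨅ k ∈ Set.Ioi d, (coeff k).ker

theorem mem_degreeLE {d : ℕ} {p : OreExtension σ δ} :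
    p ∈ degreeLE σ δ d ↔ ∀ k, d < k → coeff k p = 0 := by
  simp [degreeLE, AddSubgroup.mem_iInf, AddMonoidHom.mem_ker]

/-- The coefficients of `X^d` of the elements of `I` of degree at most `d`. -/
noncomputable def leadingCoeffs (I : AddSubgroup (OreExtension σ δ)) (d : ℕ) : AddSubgroup R :=
  (I ⊓ degreeLE σ δ d).map (coeff d)

theorem mem_leadingCoeffs {I : AddSubgroup (OreExtension σ δ)} {d : ℕ} {a : R} :
    a ∈ leadingCoeffs I d ↔ ∃ p ∈ I, (∀ k, d < k → coeff k p = 0) ∧ coeff d p = a := by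
  simp [leadingCoeffs, mem_degreeLE, and_assoc]

theorem leadingCoeffs_mono {I J : AddSubgroup (OreExtension σ δ)} (h : I ≤ J) (d : ℕ) :
    leadingCoeffs I d ≤ leadingCoeffs J d :=
  AddSubgroup.map_mono (inf_le_inf_right _ h)

theorem le_of_leadingCoeffs_le {I J : AddSubgroup (OreExtension σ δ)} (hIJ : I ≤ J)
    (h : ∀ d, leadingCoeffs J d ≤ leadingCoeffs I d) : J ≤ I := by
  -- Induction on a strict degree bound, so that d = 0 forces p = 0; an element of I with the same
  -- leading coefficient is subtracted.
  have key : ∀ d, ∀ p ∈ J, (∀ k, d ≤ k → coeff k p = 0) → p ∈ I := by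
    intro d
    induction d with
    | zero =>
      intro p _ hp
      have : p = 0 := coeff_ext fun k => by rw [hp k (Nat.zero_le k), map_zero]
      exact this ▸ I.zero_mem
    | succ d ih =>
      intro p hpJ hp
      obtain ⟨q, hq, hqd, hqp⟩ := mem_leadingCoeffs.1 (h d (mem_leadingCoeffs.2 ⟨p, hpJ, hp, rfl⟩))
      rw [← sub_add_cancel p q]
      refine I.add_mem (ih _ (J.sub_mem hpJ (hIJ hq)) fun k hk => ?_) hq
      rw [map_sub]
      rcases hk.eq_or_lt with rfl | hk
      · rw [hqp, sub_self]
      · rw [hp k hk, hqd k hk, sub_self]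
  intro p hp
  obtain ⟨d, hd⟩ := exists_coeff_eq_zero p
  exact key d p hp hd

theorem map_mem_leadingCoeffs {α : R →+ R} {I : AddSubgroup (OreExtension σ δ)}
    (hI : ∀ p ∈ I, twist σ δ α p ∈ I) {d : ℕ} {a : R} (ha : a ∈ leadingCoeffs I d) :
    α a ∈ leadingCoeffs I d := by
  obtain ⟨p, hp, hd, rfl⟩ := mem_leadingCoeffs.1 ha
  refine mem_leadingCoeffs.2 ⟨_, hI p hp, fun k hk => ?_, ?_⟩ <;>
    rw [twist_eq_mapCoeff, coeff_mapCoeff]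
  rw [hd k hk, map_zero]

theorem coeff_iterate_mulX_monomial_zero (m : ℕ) (b : R) :
    (∀ k, m < k → coeff k (mulX^[m] (monomial 0 b : OreExtension σ δ)) = 0) ∧
      coeff m (mulX^[m] (monomial 0 b : OreExtension σ δ)) = σ^[m] b := by
  induction m with
  | zero =>
    refine ⟨fun k hk => ?_, ?_⟩
    · simp [coeff_monomial, hk.ne]
    · simp [coeff_monomial]
  | succ m ih =>
    rw [Function.iterate_succ_apply', Function.iterate_succ_apply']
    refine ⟨fun k hk => ?_, ?_⟩
    · obtain ⟨k, rfl⟩ := Nat.exists_eq_succ_of_ne_zero (Nat.ne_zero_of_lt hk)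
      rw [Nat.succ_eq_add_one, coeff_succ_mulX, ih.1 k (by omega), ih.1 (k + 1) (by omega),
        map_zero, map_zero, add_zero]
    · rw [coeff_succ_mulX, ih.2, ih.1 (m + 1) (Nat.lt_succ_self m), map_zero, add_zero]

theorem sum_monomial {d : ℕ} {p : OreExtension σ δ} (hp : ∀ k, d < k → coeff k p = 0) :
    p = ∑ i ∈ Finset.range (d + 1), monomial i (coeff i p) := by
  refine coeff_ext fun k => ?_
  simp only [map_sum, coeff_monomial, Finset.sum_ite_eq', Finset.mem_range]
  split_ifs with h
  · rfl
  · exact hp k (by omega)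

/-- Moving b to the left past X^i gives σ^i(b)X^i plus lower terms, so only i = d reaches degree d.
-/
theorem coeff_mul_monomial_zero {d : ℕ} {p : OreExtension σ δ}
    (hp : ∀ k, d < k → coeff k p = 0) (b : R) :
    (∀ k, d < k → coeff k (p * monomial 0 b) = 0) ∧
      coeff d (p * monomial 0 b) = coeff d p * σ^[d] b := by
  have key : ∀ k, coeff k (p * monomial 0 b) = ∑ i ∈ Finset.range (d + 1),
      coeff i p * coeff k (mulX^[i] (monomial 0 b : OreExtension σ δ)) := by
    intro k
    conv_lhs => rw [sum_monomial hp]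
    simp [Finset.sum_mul, monomial_mul, coeff_mapCoeff]
  refine ⟨fun k hk => ?_, ?_⟩
  · rw [key]
    refine Finset.sum_eq_zero fun i hi => ?_
    rw [(coeff_iterate_mulX_monomial_zero i b).1 k (by rw [Finset.mem_range] at hi; omega),
      mul_zero]
  · rw [key, Finset.sum_range_succ, (coeff_iterate_mulX_monomial_zero d b).2,
      Finset.sum_eq_zero, zero_add]
    intro i hi
    rw [(coeff_iterate_mulX_monomial_zero i b).1 d (Finset.mem_range.1 hi), mul_zero]

theorem isRightHomIdeal_leadingCoeffs (hσ : Function.Surjective σ) {α : R →+ R}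
    {I : AddSubgroup (OreExtension σ δ)} (hI : IsRightHomIdeal (twist σ δ α) I) (d : ℕ) :
    IsRightHomIdeal α (leadingCoeffs I d) where
  mul_mem a ha r := by
    obtain ⟨p, hp, hd, rfl⟩ := mem_leadingCoeffs.1 ha
    -- Right multiplication by s multiplies the leading coefficient by σ^d(s), so r must be written
    -- in that form.
    obtain ⟨s, rfl⟩ := hσ.iterate d r
    obtain ⟨h1, h2⟩ := coeff_mul_monomial_zero hd s
    exact mem_leadingCoeffs.2 ⟨_, hI.mul_mem p hp _, h1, h2⟩
  map_mem _ := map_mem_leadingCoeffs hI.map_mem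

/-- Right multiplication by `X` is the plain shift, which keeps the leading coefficient untwisted.
-/
theorem monotone_leadingCoeffs (hσ : σ 1 = 1) (hδ : δ 1 = 0) {α : R →+ R}
    {I : AddSubgroup (OreExtension σ δ)} (hI : IsRightHomIdeal (twist σ δ α) I) :
    Monotone (leadingCoeffs I) := by
  refine monotone_nat_of_le_succ fun d a ha => ?_
  obtain ⟨p, hp, hd, rfl⟩ := mem_leadingCoeffs.1 ha
  refine mem_leadingCoeffs.2 ⟨_, mul_monomial_one hσ hδ p ▸ hI.mul_mem p hp _, fun k hk => ?_,
    coeff_shift_succ d p⟩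
  obtain ⟨k, rfl⟩ := Nat.exists_eq_succ_of_ne_zero (Nat.ne_zero_of_lt hk)
  exact (coeff_shift_succ k p).trans (hd k (by omega))

theorem isLeftHomIdeal_leadingCoeffs {α : R →+ R} {I : AddSubgroup (OreExtension σ δ)}
    (hI : IsLeftHomIdeal (twist σ δ α) I) (d : ℕ) :
    IsLeftHomIdeal α (leadingCoeffs I d) where
  mul_mem a ha r := by
    obtain ⟨p, hp, hd, rfl⟩ := mem_leadingCoeffs.1 ha
    refine mem_leadingCoeffs.2 ⟨_, monomial_zero_mul r p ▸ hI.mul_mem p hp _, fun k hk => ?_, ?_⟩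
    · simp [coeff_mapCoeff, hd k hk]
    · simp [coeff_mapCoeff]
  map_mem _ := map_mem_leadingCoeffs hI.map_mem

theorem map_mem_leadingCoeffs_succ {α : R →+ R} {I : AddSubgroup (OreExtension σ δ)}
    (hI : IsLeftHomIdeal (twist σ δ α) I) {d : ℕ} {a : R} (ha : a ∈ leadingCoeffs I d) :
    σ a ∈ leadingCoeffs I (d + 1) := by
  obtain ⟨p, hp, hd, rfl⟩ := mem_leadingCoeffs.1 ha
  refine mem_leadingCoeffs.2 ⟨_, monomial_one_mul p ▸ hI.mul_mem p hp _, fun k hk => ?_, ?_⟩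
  · obtain ⟨k, rfl⟩ := Nat.exists_eq_succ_of_ne_zero (Nat.ne_zero_of_lt hk)
    rw [Nat.succ_eq_add_one, coeff_succ_mulX, hd k (by omega), hd (k + 1) (by omega), map_zero,
      map_zero, add_zero]
  · rw [coeff_succ_mulX, hd (d + 1) (Nat.lt_succ_self d), map_zero, add_zero]

/-- The preimage of `leadingCoeffs I d` under `σ^d`. -/
noncomputable def twistedLeadingCoeffs (I : AddSubgroup (OreExtension σ δ)) (d : ℕ) : AddSubgroup R :=
  (leadingCoeffs I d).comap (σ.iterateHom d)

theorem mem_twistedLeadingCoeffs {I : AddSubgroup (OreExtension σ δ)} {d : ℕ} {a : R} :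
    a ∈ twistedLeadingCoeffs I d ↔ σ^[d] a ∈ leadingCoeffs I d := by
  rw [twistedLeadingCoeffs, AddSubgroup.mem_comap, AddMonoidHom.iterateHom_apply]

theorem isLeftHomIdeal_twistedLeadingCoeffs (hσ : ∀ a b, σ (a * b) = σ a * σ b) {α : R →+ R}
    (hασ : ∀ a, α (σ a) = σ (α a)) {I : AddSubgroup (OreExtension σ δ)}
    (hI : IsLeftHomIdeal (twist σ δ α) I) (d : ℕ) :
    IsLeftHomIdeal α (twistedLeadingCoeffs I d) where
  mul_mem a ha r := by
    rw [mem_twistedLeadingCoeffs] at ha ⊢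
    rw [Function.Semiconj₂.iterate hσ d r a]
    exact (isLeftHomIdeal_leadingCoeffs hI d).mul_mem _ ha _
  map_mem a ha := by
    rw [mem_twistedLeadingCoeffs] at ha ⊢
    rw [← Function.Commute.iterate_right (f := α) (g := σ) hασ d a]
    exact (isLeftHomIdeal_leadingCoeffs hI d).map_mem _ ha

theorem monotone_twistedLeadingCoeffs {α : R →+ R} {I : AddSubgroup (OreExtension σ δ)}
    (hI : IsLeftHomIdeal (twist σ δ α) I) : Monotone (twistedLeadingCoeffs I) := by
  refine monotone_nat_of_le_succ fun d a ha => ?_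
  rw [mem_twistedLeadingCoeffs] at ha ⊢
  rw [Function.iterate_succ_apply']
  exact map_mem_leadingCoeffs_succ hI ha

end LeadingCoeff

end OreExtension

/-- If the members of a class of elements of a partial order satisfy the ascending chain condition,
then a family of them that is monotone in two natural parameters becomes constant in the first
parameter, uniformly in the second. -/
theorem exists_forall_eq_of_monotone₂ {A : Type*} [PartialOrder A] {P : A → Prop}
    (hP : ∀ u : ℕ → A, (∀ n, P (u n)) → Monotone u → ∃ n, ∀ m, n ≤ m → u m = u n)
    (F : ℕ → ℕ → A) (hF : ∀ n d, P (F n d)) (hmono : ∀ d, Monotone fun n => F n d)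
    (hmono' : ∀ n, Monotone (F n)) : ∃ N, ∀ n, N ≤ n → ∀ d, F n d = F N d := by
  -- Stability of the diagonal from N on settles every d ≥ N; the finitely many d < N are treated
  -- one by one.
  obtain ⟨N, hN⟩ := hP (fun n => F n n) (fun n => hF n n)
    fun m n h => (hmono m h).trans (hmono' n h)
  have hconst : ∀ n d, N ≤ n → N ≤ d → F n d = F N N := by
    intro n d hn hd
    refine le_antisymm ?_ ((hmono N hn).trans (hmono' n hd))
    exact ((hmono d (le_max_left n d)).trans (hmono' _ (le_max_right n d))).trans
      (hN _ (hn.trans (le_max_left n d))).le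
  choose M hM using fun d => hP (fun n => F n d) (fun n => hF n d) (hmono d)
  refine ⟨max N ((Finset.range N).sup M), fun n hn d => ?_⟩
  rcases lt_or_ge d N with hd | hd
  · have hMd : M d ≤ max N ((Finset.range N).sup M) :=
      (Finset.le_sup (Finset.mem_range.2 hd)).trans (le_max_right _ _)
    exact (hM d n (hMd.trans hn)).trans (hM d _ hMd).symm
  · rw [hconst n d ((le_max_left _ _).trans hn) hd, hconst _ d (le_max_left _ _) hd]

/-! ### Transfer of the chain conditions -/

namespace OreExtension

variable {R : Type*} [NonAssocRing R] {σ δ : R →+ R}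

theorem isRightHomNoetherian_twist (hσ : Function.Surjective σ) (hσ1 : σ 1 = 1) (hδ1 : δ 1 = 0)
    {α : R →+ R} (h : IsRightHomNoetherian α) : IsRightHomNoetherian (twist σ δ α) := by
  intro I hI hmono
  obtain ⟨N, hN⟩ := exists_forall_eq_of_monotone₂ h (fun n d => leadingCoeffs (I n) d)
    (fun n d => isRightHomIdeal_leadingCoeffs hσ (hI n) d)
    (fun d _ _ hmn => leadingCoeffs_mono (hmono hmn) d)
    fun n => monotone_leadingCoeffs hσ1 hδ1 (hI n)
  exact ⟨N, fun n hn => le_antisymm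
    (le_of_leadingCoeffs_le (hmono hn) fun d => (hN n hn d).le) (hmono hn)⟩

theorem isLeftHomNoetherian_twist (hσ : Function.Surjective σ)
    (hσm : ∀ a b, σ (a * b) = σ a * σ b) {α : R →+ R} (hασ : ∀ a, α (σ a) = σ (α a))
    (h : IsLeftHomNoetherian α) : IsLeftHomNoetherian (twist σ δ α) := by
  intro I hI hmono
  obtain ⟨N, hN⟩ := exists_forall_eq_of_monotone₂ h (fun n d => twistedLeadingCoeffs (I n) d)
    (fun n d => isLeftHomIdeal_twistedLeadingCoeffs hσm hασ (hI n) d)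
    (fun d _ _ hmn => AddSubgroup.comap_mono (leadingCoeffs_mono (hmono hmn) d))
    fun n => monotone_twistedLeadingCoeffs (hI n)
  refine ⟨N, fun n hn => le_antisymm
    (le_of_leadingCoeffs_le (hmono hn) fun d a ha => ?_) (hmono hn)⟩
  -- As σ^d is surjective, equal preimages under it come from equal leading coefficients.
  obtain ⟨b, rfl⟩ := hσ.iterate d a
  exact mem_twistedLeadingCoeffs.1 ((hN n hn d).le (mem_twistedLeadingCoeffs.2 ha))

end OreExtension

theorem IsSigmaDerivation.map_one {R : Type*} [NonAssocRing R] {σ δ : R →+ R}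
    (hδ : IsSigmaDerivation σ δ) (hσ : σ 1 = 1) : δ 1 = 0 := by
  simpa [hσ] using hδ 1 1

theorem mainTheorem1 {R : Type*} [NonAssocRing R] (α : R →+ R) (hα : IsHomAssociative α)
    (σ : R ≃+* R) (δ : R →+ R) (hδ : IsSigmaDerivation (σ : R →+ R) δ)
    (hασ : ∀ a : R, α (σ a) = σ (α a)) (hαδ : ∀ a : R, α (δ a) = δ (α a)) :
    IsHomAssociative (OreExtension.twist (σ : R →+ R) δ α) ∧
    (IsRightHomNoetherian α →
      IsRightHomNoetherian (OreExtension.twist (σ : R →+ R) δ α)) ∧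
    (IsLeftHomNoetherian α →
      IsLeftHomNoetherian (OreExtension.twist (σ : R →+ R) δ α)) :=
  ⟨OreExtension.isHomAssociative_twist hα (map_mul σ) hδ hασ hαδ,
    OreExtension.isRightHomNoetherian_twist σ.surjective (map_one σ) (hδ.map_one (map_one σ)),
    OreExtension.isLeftHomNoetherian_twist σ.surjective (map_mul σ) hασ⟩
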